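/- Conventions. A chain is a linearly ordered set $(C,<)$. It is scattered if no subset of $C$ with at least two elements is densely ordered by $<$. The Hausdorff degree of a chain is defined by recursion on ordinals: $\mathrm{Hdeg}(C)=0$ iff $C$ is finite; for $\alpha>0$, $\mathrm{Hdeg}(C)=\alpha$ iff $\mathrm{Hdeg}(C)\neq\beta$ for all $\beta<\alpha$ and $C=\sum_{i\in I}C_i$ is a concatenation of segments $C_i$ along a chain $I$ that is well ordered or inversely well ordered, where each $\mathrm{Hdeg}(C_i)$ equals some $\beta<\alpha$. We write $\mathrm{Hdeg}(C)\ge\omega$ if $\mathrm{Hdeg}(C)\neq n$ for every $n<\omega$. Monadic formulas are the formulas of monadic second-order logic over the language of linear orders: the atomic formulas are $x\le y$, $x=y$ and $x\in X$, and one may quantify over elements and over arbitrary subsets of the chain. For a finite tuple $\bar P=(P_0,\dots,P_{l-1})$ of subsets of $C$, a monadic formula $\varphi(x,X,\bar Z)$ with $\bar Z=(Z_0,\dots,Z_{l-1})$ is said to define, with parameters $\bar P$, a choice function on $C$ if for all $a,b\in C$ and $A\subseteq C$: 1. $C\models\varphi(a,A,\bar P)$ implies $A\neq\emptyset$ and $a\in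 A$; 2. if $A\neq\emptyset$, then $C\models\varphi(y,A,\bar P)$ for some $y\in C$; 3. $C\models\varphi(a,A,\bar P)$ and $C\models\varphi(b,A,\bar P)$ imply $a=b$. **Lemma 3.9.** Let $C$ be a scattered chain with $\mathrm{Hdeg}(C)\ge\omega$. Then for no $l<\omega$, no monadic formula $\varphi(x,X,\bar Z)$ with $\bar Z=(Z_0,\dots,Z_{l-1})$ and no $\bar P=(P_0,\dots,P_{l-1})$ with $P_i\subseteq C$ does $\varphi(x,X,\bar P)$ define a choice function on $C$. -/

import Mathlib

universe u

/-- Formulas of the monadic second-order language of linear orders, with free element variables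
`x₀, …, x₍ₙ₋₁₎` and free set variables `X₀, …, X₍ₘ₋₁₎` (de Bruijn style: a quantifier binds
variable number `0` of its body and shifts the other variables by one). The language has no
function symbols, so the only terms are the element variables. -/
inductive MonadicFormula : ℕ → ℕ → Type
  /-- the atomic formula `xᵢ ≤ xⱼ` -/
  | le {n m : ℕ} (i j : Fin n) : MonadicFormula n m
  /-- the atomic formula `xᵢ = xⱼ` -/
  | eq {n m : ℕ} (i j : Fin n) : MonadicFormula n m
  /-- the atomic formula `xᵢ ∈ Xⱼ` -/
  | mem {n m : ℕ} (i : Fin n) (j : Fin m) : MonadicFormula n m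
  /-- negation -/
  | neg {n m : ℕ} (φ : MonadicFormula n m) : MonadicFormula n m
  /-- conjunction -/
  | conj {n m : ℕ} (φ ψ : MonadicFormula n m) : MonadicFormula n m
  /-- existential quantification over elements -/
  | exElem {n m : ℕ} (φ : MonadicFormula (n + 1) m) : MonadicFormula n m
  /-- existential quantification over arbitrary subsets -/
  | exSet {n m : ℕ} (φ : MonadicFormula n (m + 1)) : MonadicFormula n m

/-- Satisfaction of a monadic formula in the chain `C`, under an assignment `v` of elements to the
element variables and an assignment `s` of subsets to the set variables. -/
def MonadicFormula.Realize {C : Type u} [LinearOrder C] :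
    {n m : ℕ} → MonadicFormula n m → (Fin n → C) → (Fin m → Set C) → Prop
  | _, _, .le i j, v, _ => v i ≤ v j
  | _, _, .eq i j, v, _ => v i = v j
  | _, _, .mem i j, v, s => v i ∈ s j
  | _, _, .neg φ, v, s => ¬ φ.Realize v s
  | _, _, .conj φ ψ, v, s => φ.Realize v s ∧ ψ.Realize v s
  | n, _, .exElem φ, v, s => ∃ a : C, φ.Realize (Fin.cons a v : Fin (n + 1) → C) s
  | _, m, .exSet φ, v, s => ∃ A : Set C, φ.Realize v (Fin.cons A s : Fin (m + 1) → Set C)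

/-- `C ⊨ φ(a, A, P̄)` for a formula `φ(x, X, Z₀, …, Z₍ₗ₋₁₎)`: the only free element variable is
`x`, the set variable number `0` is `X`, and the other set variables are the `Zᵢ`. -/
def SatisfiesAt {C : Type u} [LinearOrder C] {l : ℕ} (φ : MonadicFormula 1 (l + 1))
    (a : C) (A : Set C) (P : Fin l → Set C) : Prop :=
  φ.Realize (fun _ => a) (Fin.cons A P : Fin (l + 1) → Set C)

/-- `φ(x, X, P̄)` defines a choice function on the non-empty subsets of `C`. -/
def DefinesChoiceFunction {C : Type u} [LinearOrder C] {l : ℕ} (φ : MonadicFormula 1 (l + 1))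
    (P : Fin l → Set C) : Prop :=
  (∀ (a : C) (A : Set C), SatisfiesAt φ a A P → A.Nonempty ∧ a ∈ A) ∧
  (∀ A : Set C, A.Nonempty → ∃ a : C, SatisfiesAt φ a A P) ∧
  (∀ (a b : C) (A : Set C), SatisfiesAt φ a A P → SatisfiesAt φ b A P → a = b)

/-- A chain is scattered if it does not embed a dense order, that is, if no subset with at least
two elements is densely ordered by the induced order. -/
def IsScatteredChain (C : Type u) [LinearOrder C] : Prop :=
  ∀ S : Set C, S.Nontrivial → ¬ DenselyOrdered S

/-- `HasHdeg α C` says that the Hausdorff degree of the chain `C` equals `α`. For `α = 0` it says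
that `C` is finite. For `α > 0` it says that the degree is not smaller than `α`, and that `C` is a
sum of chains of degree smaller than `α` along an index chain `I` that is well ordered or inversely
well ordered. A decomposition of `C` into consecutive segments indexed by `I` is given by the
monotone map `f : C → I` whose fibres are the segments. -/
def HasHdeg (α : Ordinal.{u}) (C : Type u) [LinearOrder C] : Prop :=
  (α = 0 ∧ Finite C) ∨
  (α ≠ 0 ∧ (∀ β, β < α → ¬ HasHdeg β C) ∧
    ∃ (I : Type u) (_ : LinearOrder I) (f : C → I),
      (WellFoundedLT I ∨ WellFoundedGT I) ∧ Monotone f ∧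
      ∀ i : I, ∃ β, ∃ _ : β < α, HasHdeg β {x : C // f x = i})
termination_by α

/-- `HdegGE δ C` says that the Hausdorff degree of `C` is at least `δ`: it is none of the ordinals
smaller than `δ`. -/
def HdegGE (δ : Ordinal.{u}) (C : Type u) [LinearOrder C] : Prop :=
  ∀ β, β < δ → ¬ HasHdeg β C

/-! A choice formula of rank `n` cannot separate elements with the same rank-`n` type. So it
suffices to find a non-empty `A` in which each `a` has a partner `b ≠ a` in `A` such that marking
`a` or `b` gives the same type. By composition of types it is enough that this happens inside one
convex set (`Ambiguous`, `markedType_univ_eq`).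

Infinite degree provides alternating trees of every finite height: increasing sequences of
decreasing sequences of increasing sequences, and so on (`HdegGE.alternatingTree`). Types form a
finite monoid under concatenation, and pairs of a convex set and a subset are built from the leaves
of such a tree upwards. Increasing sums give pairs in which marking a point changes the type only by
a left factor (`exists_endsInOwnType_of_increasing`). A decreasing sum of such pairs is either
ambiguous or has a type generating a strictly smaller two-sided ideal (`exists_type_of_decreasing`).
Increasing sums never enlarge the ideal, so without ambiguity a tall tree would force more strict
descents than the finite monoid admits. -/

/-! ### Monadic types and their composition. -/

/-- The finite set of Hintikka types of quantifier rank `n` of a tuple of `m` subsets of a chain. -/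
def ChainType : ℕ → ℕ → Type
  | 0, m => (Fin m → Fin m → Prop) × (Fin m → Fin m → Prop)
  | n + 1, m => Set (ChainType n (m + 1))

theorem ChainType.finite : ∀ n m, Finite (ChainType n m)
  | 0, m => inferInstanceAs (Finite ((Fin m → Fin m → Prop) × (Fin m → Fin m → Prop)))
  | n + 1, m =>
    haveI := ChainType.finite n (m + 1)
    inferInstanceAs (Finite (Set (ChainType n (m + 1))))

instance (n m : ℕ) : Finite (ChainType n m) := ChainType.finite n m

/-- Quantifier free types under concatenation of chains. -/
abbrev ChainType.monoidZero (m : ℕ) : Monoid (ChainType 0 m) where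
  -- The last disjunct accounts for a point of the `i`-th set on the left and one of the `j`-th set
  -- on the right, which are automatically in order.
  mul p q := (fun i j => p.1 i j ∨ q.1 i j, fun i j => p.2 i j ∨ q.2 i j ∨ (p.1 i i ∧ q.1 j j))
  one := (fun _ _ => False, fun _ _ => False)
  mul_assoc p q r := by
    refine Prod.ext ?_ ?_ <;> funext i j <;> apply propext
    · change ((p.1 i j ∨ q.1 i j) ∨ r.1 i j) ↔ (p.1 i j ∨ q.1 i j ∨ r.1 i j)
      tauto
    · change ((p.2 i j ∨ q.2 i j ∨ (p.1 i i ∧ q.1 j j)) ∨ r.2 i j ∨ ((p.1 i i ∨ q.1 i i) ∧ r.1 j j)) ↔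
        (p.2 i j ∨ (q.2 i j ∨ r.2 i j ∨ (q.1 i i ∧ r.1 j j)) ∨ (p.1 i i ∧ (q.1 j j ∨ r.1 j j)))
      tauto
  one_mul p := by
    refine Prod.ext ?_ ?_ <;> funext i j <;> apply propext
    · change (False ∨ p.1 i j) ↔ p.1 i j
      tauto
    · change (False ∨ p.2 i j ∨ (False ∧ p.1 j j)) ↔ p.2 i j
      tauto
  mul_one p := by
    refine Prod.ext ?_ ?_ <;> funext i j <;> apply propext
    · change (p.1 i j ∨ False) ↔ p.1 i j
      tauto
    · change (p.2 i j ∨ False ∨ (p.1 i i ∧ False)) ↔ p.2 i j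
      tauto

/-- Types form a monoid under concatenation of chains. -/
@[reducible]
noncomputable def ChainType.monoid : ∀ n m, Monoid (ChainType n m)
  | 0, m => ChainType.monoidZero m
  | n + 1, m =>
    letI := ChainType.monoid n (m + 1)
    (Set.monoid : Monoid (Set (ChainType n (m + 1))))

noncomputable instance (n m : ℕ) : Monoid (ChainType n m) := ChainType.monoid n m

theorem ChainType.mem_mul {n m : ℕ} (p q : ChainType (n + 1) m) (t : ChainType n (m + 1)) :
    t ∈ (show Set (ChainType n (m + 1)) from p * q) ↔
      ∃ a ∈ (show Set (ChainType n (m + 1)) from p), ∃ b ∈ (show Set (ChainType n (m + 1)) from q),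
        a * b = t :=
  Iff.rfl

section ChainType

variable {C : Type u} [LinearOrder C]

/-- The type of rank `n` of the subchain `D`, expanded by the traces on `D` of the sets `s i`. -/
def chainType : ∀ (n : ℕ) {m : ℕ} (_ : Set C) (_ : Fin m → Set C), ChainType n m
  | 0, _, D, s => (fun i j => ∃ x ∈ D, x ∈ s i ∧ x ∈ s j,
      fun i j => ∃ x ∈ D, ∃ y ∈ D, x ∈ s i ∧ y ∈ s j ∧ x < y)
  | n + 1, m, D, s => Set.range fun A : Set C => chainType n D (Fin.cons A s : Fin (m + 1) → Set C)

theorem chainType_congr (n : ℕ) {m : ℕ} {D : Set C} {s s' : Fin m → Set C}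
    (h : ∀ i, ∀ x ∈ D, x ∈ s i ↔ x ∈ s' i) : chainType n D s = chainType n D s' := by
  induction n generalizing m with
  | zero =>
    refine Prod.ext ?_ ?_ <;> funext i j <;> apply propext
    · exact exists_congr fun x => and_congr_right fun hx => and_congr (h i x hx) (h j x hx)
    · exact exists_congr fun x => and_congr_right fun hx => exists_congr fun y =>
        and_congr_right fun hy => and_congr (h i x hx) (and_congr_left' (h j y hy))
  | succ n ih =>
    refine congrArg Set.range (funext fun A => ih ?_)
    intro i
    refine Fin.cases (fun x _ => Iff.rfl) (fun i => ?_) i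
    simpa using h i

/-- The composition theorem: a subset of a sum is a free choice of a subset of each summand, which
is why the pointwise product of sets of types is the right multiplication at successor rank. -/
theorem chainType_union (n : ℕ) {m : ℕ} {D E : Set C} (hDE : ∀ x ∈ D, ∀ y ∈ E, x < y)
    (s : Fin m → Set C) : chainType n (D ∪ E) s = chainType n D s * chainType n E s := by
  induction n generalizing m with
  | zero =>
    refine Prod.ext ?_ ?_ <;> funext i j <;> apply propext
    · change (∃ x ∈ D ∪ E, x ∈ s i ∧ x ∈ s j) ↔
        (∃ x ∈ D, x ∈ s i ∧ x ∈ s j) ∨ (∃ x ∈ E, x ∈ s i ∧ x ∈ s j)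
      simp only [Set.mem_union, or_and_right, exists_or]
    · change (∃ x ∈ D ∪ E, ∃ y ∈ D ∪ E, x ∈ s i ∧ y ∈ s j ∧ x < y) ↔
        (∃ x ∈ D, ∃ y ∈ D, x ∈ s i ∧ y ∈ s j ∧ x < y) ∨
        (∃ x ∈ E, ∃ y ∈ E, x ∈ s i ∧ y ∈ s j ∧ x < y) ∨
        ((∃ x ∈ D, x ∈ s i ∧ x ∈ s i) ∧ (∃ x ∈ E, x ∈ s j ∧ x ∈ s j))
      constructor
      · rintro ⟨x, hx | hx, y, hy | hy, hi, hj, hxy⟩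
        · exact Or.inl ⟨x, hx, y, hy, hi, hj, hxy⟩
        · exact Or.inr (Or.inr ⟨⟨x, hx, hi, hi⟩, ⟨y, hy, hj, hj⟩⟩)
        · exact absurd (hDE y hy x hx) hxy.asymm
        · exact Or.inr (Or.inl ⟨x, hx, y, hy, hi, hj, hxy⟩)
      · rintro (⟨x, hx, y, hy, h⟩ | ⟨x, hx, y, hy, h⟩ | ⟨⟨x, hx, hi, -⟩, ⟨y, hy, hj, -⟩⟩)
        · exact ⟨x, Or.inl hx, y, Or.inl hy, h⟩
        · exact ⟨x, Or.inr hx, y, Or.inr hy, h⟩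
        · exact ⟨x, Or.inl hx, y, Or.inr hy, hi, hj, hDE x hx y hy⟩
  | succ n ih =>
    refine Set.ext fun t => (Iff.trans ?_ (ChainType.mem_mul _ _ t).symm)
    constructor
    · rintro ⟨A, rfl⟩
      exact ⟨_, ⟨A, rfl⟩, _, ⟨A, rfl⟩, (ih _).symm⟩
    · rintro ⟨_, ⟨A, rfl⟩, _, ⟨B, rfl⟩, rfl⟩
      refine ⟨(A ∩ D) ∪ (B ∩ E), (ih _).trans (congrArg₂ _ ?_ ?_)⟩ <;>
        refine chainType_congr n fun i => ?_ <;> refine Fin.cases (fun x hx => ?_) (fun i x _ => ?_) i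
      · have : x ∉ E := fun h => lt_irrefl x (hDE x hx x h)
        simp [hx, this]
      · simp
      · have : x ∉ D := fun h => lt_irrefl x (hDE x h x hx)
        simp [hx, this]
      · simp

theorem chainType_pred {n m : ℕ} {D E : Set C} {s s' : Fin m → Set C}
    (h : chainType (n + 1) D s = chainType (n + 1) E s') : chainType n D s = chainType n E s' := by
  induction n generalizing m with
  | zero =>
    -- The set `∅` is a dummy move; only the coordinates of the old tuple are read off.
    obtain ⟨A, hA⟩ : chainType 0 D (Fin.cons ∅ s : Fin (m + 1) → Set C) ∈
        Set.range fun A : Set C => chainType 0 E (Fin.cons A s' : Fin (m + 1) → Set C) :=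
      (show Set.range _ = Set.range _ from h) ▸ ⟨∅, rfl⟩
    refine Prod.ext ?_ ?_ <;> funext i j
    · exact (congrFun (congrFun (congrArg Prod.fst hA) i.succ) j.succ).symm
    · exact (congrFun (congrFun (congrArg Prod.snd hA) i.succ) j.succ).symm
  | succ n ih =>
    have h' : (Set.range fun A : Set C => chainType (n + 1) D (Fin.cons A s : Fin (m + 1) → Set C)) =
      Set.range fun A : Set C => chainType (n + 1) E (Fin.cons A s' : Fin (m + 1) → Set C) := h
    refine Set.Subset.antisymm ?_ ?_
    · rintro _ ⟨A, rfl⟩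
      obtain ⟨B, hB⟩ := h'.subset ⟨A, rfl⟩
      exact ⟨B, (ih hB.symm).symm⟩
    · rintro _ ⟨A, rfl⟩
      obtain ⟨B, hB⟩ := h'.superset ⟨A, rfl⟩
      exact ⟨B, ih hB⟩

theorem chainType_mono {n k m : ℕ} (hk : k ≤ n) {D E : Set C} {s s' : Fin m → Set C}
    (h : chainType n D s = chainType n E s') : chainType k D s = chainType k E s' := by
  induction n, hk using Nat.le_induction with
  | base => exact h
  | succ n _ ih => exact ih (chainType_pred h)

theorem chainType_succ_exists {n m : ℕ} {D E : Set C} {s s' : Fin m → Set C}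
    (h : chainType (n + 1) D s = chainType (n + 1) E s') (A : Set C) :
    ∃ B : Set C, chainType n D (Fin.cons A s : Fin (m + 1) → Set C) =
      chainType n E (Fin.cons B s' : Fin (m + 1) → Set C) := by
  obtain ⟨B, hB⟩ : chainType n D (Fin.cons A s : Fin (m + 1) → Set C) ∈
      Set.range fun A : Set C => chainType n E (Fin.cons A s' : Fin (m + 1) → Set C) :=
    (show Set.range _ = Set.range _ from h) ▸ ⟨A, rfl⟩
  exact ⟨B, hB.symm⟩

theorem chainType_meets_iff {n m : ℕ} {s s' : Fin m → Set C}
    (h : chainType n Set.univ s = chainType n Set.univ s') (i j : Fin m) :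
    (∃ x, x ∈ s i ∧ x ∈ s j) ↔ ∃ x, x ∈ s' i ∧ x ∈ s' j := by
  have h0 := congrFun (congrFun (congrArg Prod.fst (chainType_mono n.zero_le h)) i) j
  simpa [chainType] using h0

theorem chainType_lt_iff {n m : ℕ} {s s' : Fin m → Set C}
    (h : chainType n Set.univ s = chainType n Set.univ s') (i j : Fin m) :
    (∃ x, ∃ y, x ∈ s i ∧ y ∈ s j ∧ x < y) ↔ ∃ x, ∃ y, x ∈ s' i ∧ y ∈ s' j ∧ x < y := by
  have h0 := congrFun (congrFun (congrArg Prod.snd (chainType_mono n.zero_le h)) i) j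
  simpa [chainType] using h0

/-- Being a singleton is visible at rank `0`: the set meets itself and contains no pair `x < y`.
Hence element quantifiers can be treated as set quantifiers. -/
theorem chainType_eq_singleton {n m : ℕ} {s s' : Fin m → Set C}
    (h : chainType n Set.univ s = chainType n Set.univ s') {i : Fin m} {a : C} (hi : s i = {a}) :
    ∃ b, s' i = {b} := by
  obtain ⟨b, hb, -⟩ := (chainType_meets_iff h i i).1 ⟨a, by simp [hi]⟩
  refine ⟨b, Set.eq_singleton_iff_unique_mem.2 ⟨hb, fun c hc => ?_⟩⟩
  have hn : ¬ ∃ x, ∃ y, x ∈ s' i ∧ y ∈ s' i ∧ x < y := by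
    rw [← chainType_lt_iff h i i]
    rintro ⟨x, y, hx, hy, hxy⟩
    rw [hi] at hx hy
    exact hxy.ne (hx.trans hy.symm)
  by_contra hne
  rcases lt_or_gt_of_ne hne with hl | hl
  · exact hn ⟨c, b, hc, hb, hl⟩
  · exact hn ⟨b, c, hb, hc, hl⟩

/-- The quantifier rank of a formula. -/
def MonadicFormula.rank : {n m : ℕ} → MonadicFormula n m → ℕ
  | _, _, .le _ _ => 0
  | _, _, .eq _ _ => 0
  | _, _, .mem _ _ => 0
  | _, _, .neg φ => φ.rank
  | _, _, .conj φ ψ => max φ.rank ψ.rank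
  | _, _, .exElem φ => φ.rank + 1
  | _, _, .exSet φ => φ.rank + 1

/-- Tuples of the same type satisfy the same formulas; an element variable is represented by a
singleton of the tuple. -/
theorem MonadicFormula.realize_iff_of_chainType_eq {n m : ℕ} (φ : MonadicFormula n m) {k N : ℕ}
    (hk : φ.rank ≤ k) (e : Fin n → Fin N) (g : Fin m → Fin N) {w w' : Fin N → Set C}
    (h : chainType k Set.univ w = chainType k Set.univ w') {v v' : Fin n → C}
    (hv : ∀ i, w (e i) = {v i}) (hv' : ∀ i, w' (e i) = {v' i}) :
    φ.Realize v (w ∘ g) ↔ φ.Realize v' (w' ∘ g) := by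
  induction φ generalizing k N with
  | le i j =>
    have := chainType_lt_iff h (e j) (e i)
    simp only [hv, hv'] at this
    simpa [Realize] using not_congr this
  | eq i j =>
    have := chainType_meets_iff h (e i) (e j)
    simpa [hv, hv', Realize] using this
  | mem i j =>
    have := chainType_meets_iff h (e i) (g j)
    simpa [hv, hv', Realize] using this
  | neg φ ih => exact not_congr (ih hk e g h hv hv')
  | conj φ ψ ih₁ ih₂ =>
    exact and_congr (ih₁ ((le_max_left _ _).trans hk) e g h hv hv')
      (ih₂ ((le_max_right _ _).trans hk) e g h hv hv')
  | @exElem n m φ ih =>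
    obtain ⟨k, rfl⟩ : ∃ k', k = k' + 1 := ⟨k - 1, by simp only [rank] at hk; omega⟩
    have key : ∀ {w w' : Fin N → Set C} {v v' : Fin n → C}
        (_ : chainType (k + 1) Set.univ w = chainType (k + 1) Set.univ w')
        (_ : ∀ i, w (e i) = {v i}) (_ : ∀ i, w' (e i) = {v' i}),
        (φ.exElem).Realize v (w ∘ g) → (φ.exElem).Realize v' (w' ∘ g) := by
      rintro w w' v v' h hv hv' ⟨a, ha⟩
      obtain ⟨B, hB⟩ := chainType_succ_exists h {a}
      obtain ⟨b, hb⟩ := chainType_eq_singleton hB (i := 0) (a := a) rfl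
      obtain rfl : B = {b} := hb
      refine ⟨b, (ih (Nat.le_of_succ_le_succ hk) (Fin.cons 0 (Fin.succ ∘ e)) (Fin.succ ∘ g) hB
        ?_ ?_).1 ha⟩ <;> refine Fin.cases rfl (fun i => ?_)
      · simpa using hv i
      · simpa using hv' i
    exact ⟨key h hv hv', key h.symm hv' hv⟩
  | @exSet n m φ ih =>
    obtain ⟨k, rfl⟩ : ∃ k', k = k' + 1 := ⟨k - 1, by simp only [rank] at hk; omega⟩
    have key : ∀ {w w' : Fin N → Set C} {v v' : Fin n → C}
        (_ : chainType (k + 1) Set.univ w = chainType (k + 1) Set.univ w')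
        (_ : ∀ i, w (e i) = {v i}) (_ : ∀ i, w' (e i) = {v' i}),
        (φ.exSet).Realize v (w ∘ g) → (φ.exSet).Realize v' (w' ∘ g) := by
      rintro w w' v v' h hv hv' ⟨A, hA⟩
      obtain ⟨B, hB⟩ := chainType_succ_exists h A
      have hcons : ∀ (A : Set C) (w : Fin N → Set C), (Fin.cons A w : Fin (N + 1) → Set C) ∘
          (Fin.cons 0 (Fin.succ ∘ g) : Fin (m + 1) → Fin (N + 1)) = Fin.cons A (w ∘ g) := by
        intro A w
        funext i
        refine Fin.cases rfl (fun i => ?_) i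
        simp
      have := (ih (Nat.le_of_succ_le_succ hk) (Fin.succ ∘ e) (Fin.cons 0 (Fin.succ ∘ g)) hB
        (v := v) (v' := v') (fun i => by simpa using hv i) (fun i => by simpa using hv' i)).1
      rw [hcons, hcons] at this
      exact ⟨B, this hA⟩
    exact ⟨key h hv hv', key h.symm hv' hv⟩

end ChainType

/-! ### Alternating trees. -/

/-- `AlternatingTree r k D`: the set `D` contains the leaves of a tree of height `k` in which every
inner node has infinitely many children `E 0, E 1, …`, which are ordered by `r` at even and by the
converse of `r` at odd distance from the root. -/
def AlternatingTree {C : Type*} : (C → C → Prop) → ℕ → Set C → Prop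
  | _, 0, D => D.Nonempty
  | r, k + 1, D => ∃ E : ℕ → Set C, (∀ i, E i ⊆ D) ∧
      (∀ i j, i < j → ∀ x ∈ E i, ∀ y ∈ E j, r x y) ∧ ∀ i, AlternatingTree (flip r) k (E i)

namespace AlternatingTree

theorem mono {C : Type*} {r : C → C → Prop} : ∀ {k : ℕ} {D D' : Set C}, D ⊆ D' →
    AlternatingTree r k D → AlternatingTree r k D'
  | 0, _, _, h, hD => Set.Nonempty.mono h hD
  | _ + 1, _, _, h, ⟨E, hE, hr, ht⟩ => ⟨E, fun i => (hE i).trans h, hr, ht⟩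

theorem nonempty {C : Type*} : ∀ {r : C → C → Prop} {k : ℕ} {D : Set C},
    AlternatingTree r k D → D.Nonempty
  | _, 0, _, h => h
  | _, _ + 1, _, ⟨_, hE, _, ht⟩ => ((ht 0).nonempty).mono (hE 0)

theorem image {C C' : Type*} (e : C → C') {k : ℕ} {r : C → C → Prop} {r' : C' → C' → Prop}
    (he : ∀ x y, r x y → r' (e x) (e y)) {D : Set C} (h : AlternatingTree r k D) :
    AlternatingTree r' k (e '' D) := by
  induction k generalizing r r' D with
  | zero => exact Set.Nonempty.image e h
  | succ k ih =>
    obtain ⟨E, hE, hr, ht⟩ := h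
    refine ⟨fun i => e '' E i, fun i => Set.image_mono (hE i), ?_,
      fun i => ih (fun x y h => he y x h) (ht i)⟩
    rintro i j hij _ ⟨x, hx, rfl⟩ _ ⟨y, hy, rfl⟩
    exact he _ _ (hr i j hij x hx y hy)

theorem exists_rel {C : Type*} {r : C → C → Prop} {k : ℕ} {D : Set C}
    (h : AlternatingTree r (k + 1) D) : ∃ x ∈ D, ∃ y ∈ D, r x y := by
  obtain ⟨E, hE, hr, ht⟩ := h
  obtain ⟨x, hx⟩ := (ht 0).nonempty
  obtain ⟨y, hy⟩ := (ht 1).nonempty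
  exact ⟨x, hE 0 hx, y, hE 1 hy, hr 0 1 one_pos x hx y hy⟩

/-- Trees with inversely ordered children of the root are additively indecomposable. -/
theorem of_union {C : Type*} [LinearOrder C] {k : ℕ} {D D' : Set C}
    (hD : ∀ x ∈ D, ∀ y ∈ D', x ≤ y)
    (h : AlternatingTree (fun x y : C => y < x) (k + 1) (D ∪ D')) :
    AlternatingTree (fun x y : C => y < x) (k + 1) D ∨
      AlternatingTree (fun x y : C => y < x) (k + 1) D' := by
  obtain ⟨E, hE, hr, ht⟩ := h
  -- Once a child meets `D` in a point, all later children lie below that point, hence in `D`;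
  -- otherwise every child lies in `D'`.
  by_cases hex : ∃ i, ∃ x ∈ E i, x ∈ D
  · obtain ⟨i, x, hx, hxD⟩ := hex
    refine Or.inl ⟨fun j => E (i + 1 + j), fun j y hy => ?_,
      fun a b hab => hr _ _ (by omega), fun j => ht _⟩
    have hyx : y < x := hr i (i + 1 + j) (by omega) x hx y hy
    exact (hE _ hy).resolve_right fun hy' => (hD x hxD y hy').not_gt hyx
  · push Not at hex
    exact Or.inr ⟨E, fun i x hx => (hE i hx).resolve_left (hex i x hx), hr, ht⟩

end AlternatingTree

/-! ### Bounded Hausdorff degree and trees of bounded height. -/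

/-- `HdegLE k C`: the Hausdorff degree of `C` is at most `k`. -/
def HdegLE : ℕ → ∀ (C : Type u) [LinearOrder C], Prop
  | 0, C, _ => Finite C
  | k + 1, C, _ => HdegLE k C ∨ ∃ (I : Type u) (_ : LinearOrder I) (f : C → I),
      (WellFoundedLT I ∨ WellFoundedGT I) ∧ Monotone f ∧ ∀ i : I, HdegLE k {x : C // f x = i}

namespace HdegLE

theorem exists_hasHdeg {k : ℕ} {C : Type u} [LinearOrder C] (h : HdegLE k C) :
    ∃ β : Ordinal.{u}, β ≤ k ∧ HasHdeg β C := by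
  induction k generalizing C with
  | zero => exact ⟨0, le_rfl, by rw [HasHdeg]; exact Or.inl ⟨rfl, h⟩⟩
  | succ k ih =>
    rcases h with h | ⟨I, hI, f, hwf, hf, hfib⟩
    · obtain ⟨β, hβ, hd⟩ := ih h
      exact ⟨β, hβ.trans (by exact_mod_cast k.le_succ), hd⟩
    · by_cases hlt : ∃ β : Ordinal.{u}, β < (k + 1 : ℕ) ∧ HasHdeg β C
      · obtain ⟨β, hβ, hd⟩ := hlt
        exact ⟨β, hβ.le, hd⟩
      · push Not at hlt
        refine ⟨(k + 1 : ℕ), le_rfl, ?_⟩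
        rw [HasHdeg]
        refine Or.inr ⟨by exact_mod_cast k.succ_ne_zero, hlt, I, hI, f, hwf, hf, fun i => ?_⟩
        obtain ⟨β, hβ, hd⟩ := ih (hfib i)
        exact ⟨β, hβ.trans_lt (by exact_mod_cast k.lt_succ_self), hd⟩

theorem of_strictMono {k : ℕ} {C C' : Type u} [LinearOrder C] [LinearOrder C'] {e : C → C'}
    (he : StrictMono e) (h : HdegLE k C') : HdegLE k C := by
  induction k generalizing C C' with
  | zero =>
    have : Finite C' := h
    exact Finite.of_injective e he.injective
  | succ k ih =>
    rcases h with h | ⟨I, hI, f, hwf, hf, hfib⟩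
    · exact Or.inl (ih he h)
    · refine Or.inr ⟨I, hI, f ∘ e, hwf, hf.comp he.monotone, fun i => ?_⟩
      exact ih (e := fun x : {x : C // (f ∘ e) x = i} => (⟨e x.1, x.2⟩ : {x : C' // f x = i}))
        (fun x y hxy => he hxy) (hfib i)

theorem dual {k : ℕ} {C : Type u} [LinearOrder C] (h : HdegLE k C) : HdegLE k Cᵒᵈ := by
  induction k generalizing C with
  | zero => exact h
  | succ k ih =>
    rcases h with h | ⟨I, hI, f, hwf, hf, hfib⟩
    · exact Or.inl (ih h)
    · refine Or.inr ⟨Iᵒᵈ, inferInstance, fun x => OrderDual.toDual (f (OrderDual.ofDual x)),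
        ?_, hf.dual, fun i => ih (hfib (OrderDual.ofDual i))⟩
      rcases hwf with hwf | hwf
      · exact Or.inr inferInstance
      · exact Or.inl inferInstance

/-- Send `x` to the least element of `Set.Ici x` for a fixed well-ordering of `C`. On the values of
this map the chain order agrees with the well-ordering, and the fibre over `a` lies in `Set.Iic a`.
-/
theorem of_Iic {k : ℕ} {C : Type u} [LinearOrder C] (h : ∀ a : C, HdegLE k (Set.Iic a)) :
    HdegLE (k + 1) C := by
  have wf : WellFounded (WellOrderingRel : C → C → Prop) := IsWellFounded.wf
  have hne : ∀ x : C, (Set.Ici x).Nonempty := fun x => ⟨x, le_rfl⟩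
  set g : C → C := fun x => wf.min (Set.Ici x) (hne x) with hg
  have hle : ∀ x, x ≤ g x := fun x => wf.min_mem (Set.Ici x) (hne x)
  have hmin : ∀ x y, x ≤ y → ¬ WellOrderingRel y (g x) := fun x y hxy => wf.not_lt_min _ hxy
  have hcase : ∀ x y, x ≤ y → g x = g y ∨ g x < g y ∧ WellOrderingRel (g x) (g y) := by
    intro x y hxy
    rcases trichotomous_of (WellOrderingRel : C → C → Prop) (g x) (g y) with h | h | h
    · refine Or.inr ⟨?_, h⟩
      by_contra hlt
      exact hmin y (g x) ((hle y).trans (not_lt.1 hlt)) h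
    · exact Or.inl h
    · exact absurd h (hmin x _ (hxy.trans (hle y)))
  have hmono : Monotone g := fun x y hxy => (hcase x y hxy).elim Eq.le fun h => h.1.le
  refine Or.inr ⟨Set.range g, inferInstance, Set.rangeFactorization g, Or.inl ?_, ?_, ?_⟩
  · refine ⟨Subrelation.wf (r := InvImage WellOrderingRel Subtype.val) ?_ (InvImage.wf _ wf)⟩
    rintro ⟨_, x, rfl⟩ ⟨_, y, rfl⟩ hxy
    have hxy' : g x < g y := hxy
    have : x ≤ y := le_of_not_gt fun h => (hmono h.le).not_gt hxy'
    exact ((hcase x y this).resolve_left hxy'.ne).2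
  · exact fun x y hxy => hmono hxy
  · rintro ⟨a, -⟩
    refine of_strictMono (e := fun x => (⟨x.1, ?_⟩ : Set.Iic a)) (fun x y hxy => hxy) (h a)
    have : g x.1 = a := congrArg Subtype.val x.2
    exact (hle x.1).trans_eq this

theorem of_Ici {k : ℕ} {C : Type u} [LinearOrder C] (h : ∀ a : C, HdegLE k (Set.Ici a)) :
    HdegLE (k + 1) C := by
  have : HdegLE (k + 1) Cᵒᵈ := of_Iic fun a =>
    of_strictMono (C' := (Set.Ici (OrderDual.ofDual a))ᵒᵈ)
      (e := fun x => OrderDual.toDual ⟨OrderDual.ofDual x.1, x.2⟩) (fun _ _ hxy => hxy)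
      (h (OrderDual.ofDual a)).dual
  exact this.dual

theorem of_Icc {k : ℕ} {C : Type u} [LinearOrder C] (h : ∀ a b : C, HdegLE k (Set.Icc a b)) :
    HdegLE (k + 2) C :=
  of_Iic fun b => of_Ici fun a =>
    of_strictMono (C' := Set.Icc a.1 b) (e := fun x => ⟨x.1.1, x.2, x.1.2⟩) (fun _ _ hxy => hxy)
      (h a.1 b)

end HdegLE

theorem wellFoundedGT_of_forall_nat {I : Type*} [LinearOrder I]
    (h : ∀ x : ℕ → I, ¬ StrictMono x) : WellFoundedGT I := by
  rw [WellFoundedGT, isWellFounded_iff, RelEmbedding.wellFounded_iff_isEmpty]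
  exact ⟨fun f => h f fun i j hij => f.map_rel_iff.2 hij⟩

/-- Points are grouped so that no interval inside a class carries the inverse tree of smaller
height. By induction such intervals have degree at most `3 * k + 1`; passing to the class costs two,
one for each end, and summing the classes costs one more. -/
theorem hdegLE_of_not_alternatingTree {k : ℕ} {C : Type u} [LinearOrder C]
    (h : ¬ AlternatingTree (fun x y : C => x < y) (k + 1) Set.univ) : HdegLE (3 * k + 1) C := by
  induction k generalizing C with
  | zero =>
    refine Or.inr ⟨C, inferInstance, id, Or.inr ?_, monotone_id, fun i => ?_⟩
    · refine wellFoundedGT_of_forall_nat fun x hx => h ⟨fun i => {x i}, fun i => Set.subset_univ _,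
        ?_, fun i => Set.singleton_nonempty _⟩
      rintro i j hij _ rfl _ rfl
      exact hx hij
    · exact (inferInstance : Finite {x : C // x = i})
  | succ k ih =>
    have ih' : ∀ a b : C, ¬ AlternatingTree (fun x y : C => y < x) (k + 1) (Set.Icc a b) →
        HdegLE (3 * k + 1) (Set.Icc a b) := by
      intro a b hab
      refine (ih (C := (Set.Icc a b)ᵒᵈ) fun ht => hab ?_).dual
      refine (ht.image (fun x : (Set.Icc a b)ᵒᵈ => (OrderDual.ofDual x).1) (fun x y hxy => hxy)).mono ?_
      rintro _ ⟨x, -, rfl⟩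
      exact (OrderDual.ofDual x).2
    set T : Set C → Prop := AlternatingTree (fun x y : C => y < x) (k + 1) with hT
    have hself : ∀ a : C, ¬ T (Set.Icc a a) := by
      intro a ha
      obtain ⟨x, hx, y, hy, hxy⟩ := ha.exists_rel
      rw [Set.Icc_self] at hx hy
      exact hxy.ne (hy.trans hx.symm)
    -- By indecomposability of the tree, `f x < f x'` forces a tree already in `Set.Icc x x'`. An
    -- increasing sequence of values would therefore produce a tree that is one level higher.
    let f : C → LowerSet C := fun x => ⟨{y | ¬ T (Set.Icc x y)},
      fun y z hzy hy hz => hy (hz.mono (Set.Icc_subset_Icc_right hzy))⟩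
    have hf : Monotone f := fun x x' hxx' y hy hy' =>
      hy (hy'.mono (Set.Icc_subset_Icc_left hxx'))
    have hlt : ∀ x x', f x < f x' → T (Set.Icc x x') := by
      intro x x' hxx'
      have hx : x ≤ x' := le_of_not_gt fun h => (hf h.le).not_gt hxx'
      obtain ⟨y, hy, hy'⟩ := Set.not_subset.1 (not_le_of_gt hxx')
      have hyx : T (Set.Icc x y) := not_not.1 hy'
      refine (AlternatingTree.of_union (D := Set.Icc x x') (D' := Set.Icc x' y)
        (fun a ha b hb => ha.2.trans hb.1) (hyx.mono ?_)).resolve_right hy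
      intro z hz
      exact (le_total z x').imp (fun h => ⟨hz.1, h⟩) fun h => ⟨h, hz.2⟩
    refine Or.inr ⟨Set.range f, inferInstance, Set.rangeFactorization f, Or.inr ?_,
      fun x y hxy => hf hxy, fun i => ?_⟩
    · refine wellFoundedGT_of_forall_nat fun x hx => h ?_
      choose y hy using fun i => (x i).2
      have hlt' : ∀ i j, i < j → f (y i) < f (y j) := fun i j hij => by
        rw [hy, hy]
        exact hx hij
      -- Using every second interval keeps the children of the new root disjoint.
      refine ⟨fun i => Set.Icc (y (2 * i)) (y (2 * i + 1)), fun i => Set.subset_univ _, ?_,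
        fun i => hlt _ _ (hlt' _ _ (by omega))⟩
      intro i j hij a ha b hb
      have h1 : y (2 * i + 1) < y (2 * j) :=
        lt_of_not_ge fun h => (hf h).not_gt (hlt' _ _ (by omega))
      exact ha.2.trans_lt (h1.trans_le hb.1)
    · refine HdegLE.of_Icc fun a b => HdegLE.of_strictMono (C' := Set.Icc a.1 b.1)
        (e := fun x => ⟨x.1.1, x.2⟩) (fun x y hxy => hxy) (ih' _ _ ?_)
      have hab : f a.1 = f b.1 := congrArg Subtype.val (a.2.trans b.2.symm)
      have hb : b.1 ∈ f b.1 := hself b.1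
      rw [← hab] at hb
      exact hb

/-- Chains of infinite Hausdorff degree contain alternating trees of every finite height. -/
theorem HdegGE.alternatingTree {C : Type u} [LinearOrder C] (h : HdegGE Ordinal.omega0 C) (k : ℕ) :
    AlternatingTree (fun x y : C => x < y) (k + 1) Set.univ := by
  by_contra hk
  obtain ⟨β, hβ, hd⟩ := (hdegLE_of_not_alternatingTree hk).exists_hasHdeg
  exact h β (hβ.trans_lt (Ordinal.natCast_lt_omega0 _)) hd

/-! ### Ramsey argument and ideals of finite monoids. -/

/-- Along a non-principal ultrafilter each `c i` has a limit colour, and these limits have a limit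
`k`. From any index with limit `k` one can step to a larger one by an edge of colour `k`. -/
theorem exists_strictMono_forall_consecutive_eq {κ : Type*} [Finite κ] (c : ℕ → ℕ → κ) :
    ∃ f : ℕ → ℕ, StrictMono f ∧ ∃ k, ∀ m, c (f m) (f (m + 1)) = k := by
  let U : Ultrafilter ℕ := Filter.hyperfilter ℕ
  have hlim : ∀ g : ℕ → κ, ∃ k, ∀ᶠ j in (U : Filter ℕ), g j = k := fun g => by
    obtain ⟨k, hk⟩ := Ultrafilter.eq_pure_of_finite (U.map g)
    refine ⟨k, ?_⟩
    have : {k} ∈ U.map g := by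
      rw [hk]
      exact Set.mem_singleton k
    exact this
  choose L hL using fun i => hlim (c i)
  obtain ⟨k, hk⟩ := hlim L
  have hgt : ∀ i, ∀ᶠ j in (U : Filter ℕ), i < j := fun i => by
    have h : ∀ᶠ j in Filter.cofinite, i < j := by
      rw [Nat.cofinite_eq_atTop]
      exact Filter.eventually_gt_atTop i
    exact Filter.hyperfilter_le_cofinite h
  have hnext : ∀ i : {i // L i = k}, ∃ j : {i // L i = k}, i.1 < j.1 ∧ c i.1 j.1 = k := fun i => by
    obtain ⟨j, hj, hj', hj''⟩ := ((hL i.1).and (hk.and (hgt i.1))).exists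
    exact ⟨⟨j, hj'⟩, hj'', hj.trans i.2⟩
  choose next hnext using hnext
  obtain ⟨i₀, hi₀⟩ := hk.exists
  refine ⟨fun m => (next^[m] ⟨i₀, hi₀⟩).1, strictMono_nat_of_lt_succ fun m => ?_, k, fun m => ?_⟩
  · rw [Function.iterate_succ_apply']
    exact (hnext _).1
  · simp only [Function.iterate_succ_apply']
    exact (hnext _).2

theorem exists_pow_mul_pow_eq_pow {M : Type*} [Monoid M] [Finite M] (x : M) :
    ∃ p, 0 < p ∧ x ^ p * x ^ p = x ^ p := by
  obtain ⟨i, j, hij, h⟩ : ∃ i j : ℕ, i < j ∧ x ^ i = x ^ j := by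
    obtain ⟨i, j, hne, h⟩ := Finite.exists_ne_map_eq_of_infinite fun n : ℕ => x ^ n
    rcases lt_or_gt_of_ne hne with hl | hl
    · exact ⟨i, j, hl, h⟩
    · exact ⟨j, i, hl, h.symm⟩
  obtain ⟨d, rfl⟩ := Nat.exists_eq_add_of_lt hij
  have hper : ∀ t, i ≤ t → ∀ k, x ^ (t + k * (d + 1)) = x ^ t := by
    intro t ht k
    induction k with
    | zero => simp
    | succ k ih =>
      obtain ⟨s, rfl⟩ := Nat.exists_eq_add_of_le ht
      rw [← ih, show i + s + (k + 1) * (d + 1) = (i + d + 1) + (s + k * (d + 1)) by ring, pow_add,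
        ← h, ← pow_add, add_assoc]
  -- The exponent is a multiple of the period `d + 1` and lies beyond the preperiod `i`.
  refine ⟨(i + 1) * (d + 1), by positivity, ?_⟩
  rw [← pow_add]
  exact hper _ (by nlinarith) (i + 1)

/-- In a finite monoid, `u * y` generates the same left ideal as `y` if it generates the same
two-sided ideal. -/
theorem exists_eq_mul_of_eq_mul_mul {M : Type*} [Monoid M] [Finite M] {a b u y : M}
    (h : y = a * (u * y) * b) : ∃ v, y = v * (u * y) := by
  -- Iterating `h` gives `y = (a * u) ^ p * y * b ^ p`, so the idempotent `(a * u) ^ p` fixes `y`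
  -- from the left; its last factor `u` exhibits `y` as a left multiple of `u * y`.
  obtain ⟨p, hp, he⟩ := exists_pow_mul_pow_eq_pow (a * u)
  have hpow : ∀ m, y = (a * u) ^ m * y * b ^ m := by
    intro m
    induction m with
    | zero => simp
    | succ m ih =>
      calc y = (a * u) ^ m * y * b ^ m := ih
        _ = (a * u) ^ m * (a * (u * y) * b) * b ^ m := by rw [← h]
        _ = (a * u) ^ (m + 1) * y * b ^ (m + 1) := by
          rw [pow_succ, pow_succ']
          simp only [mul_assoc]
  have hy : (a * u) ^ p * y = y := by
    calc (a * u) ^ p * y = (a * u) ^ p * ((a * u) ^ p * y * b ^ p) := by rw [← hpow p]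
      _ = y := by rw [← mul_assoc, ← mul_assoc, he, ← hpow p]
  obtain ⟨q, rfl⟩ := Nat.exists_eq_add_of_lt hp
  refine ⟨(a * u) ^ q * a, ?_⟩
  rw [zero_add, pow_succ] at hy
  simpa only [mul_assoc] using hy.symm

/-- The two-sided ideal generated by an element. -/
def principalIdeal {M : Type*} [Monoid M] (y : M) : Set M := {t | ∃ u v, t = u * y * v}

theorem mem_principalIdeal_self {M : Type*} [Monoid M] (y : M) : y ∈ principalIdeal y :=
  ⟨1, 1, by simp⟩

theorem principalIdeal_subset {M : Type*} [Monoid M] {y z : M} (h : z ∈ principalIdeal y) :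
    principalIdeal z ⊆ principalIdeal y := by
  obtain ⟨u, v, rfl⟩ := h
  rintro _ ⟨a, b, rfl⟩
  exact ⟨a * u, v * b, by simp only [mul_assoc]⟩

/-! ### Marked types along increasing and decreasing sums. -/

section Marked

variable {C : Type u} [LinearOrder C] {l : ℕ} (n : ℕ) (P : Fin l → Set C)

/-- The type of the subchain `H` expanded by the traces of `X`, `A` and the parameters `P`. -/
noncomputable def markedType (H X A : Set C) : ChainType n (l + 2) :=
  chainType n H (Fin.cons X (Fin.cons A P : Fin (l + 1) → Set C) : Fin (l + 2) → Set C)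

/-- Marking an element of `A` changes the type of `(H, A)` only by a left factor. -/
def EndsInOwnType (H A : Set C) : Prop :=
  ∀ a ∈ A, ∃ r, markedType n P H {a} A = r * markedType n P H ∅ A

/-- No element of `A` is distinguished from all other ones by its type in `H`. -/
def Ambiguous (H A : Set C) : Prop :=
  H.OrdConnected ∧ A ⊆ H ∧ A.Nonempty ∧
    ∀ a ∈ A, ∃ b ∈ A, b ≠ a ∧ markedType n P H {a} A = markedType n P H {b} A

variable {n P}

theorem markedType_congr {H X X' A A' : Set C} (hX : ∀ x ∈ H, x ∈ X ↔ x ∈ X')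
    (hA : ∀ x ∈ H, x ∈ A ↔ x ∈ A') : markedType n P H X A = markedType n P H X' A' := by
  refine chainType_congr n fun i => ?_
  refine Fin.cases hX (fun i => ?_) i
  refine Fin.cases ?_ (fun i => ?_) i
  · simpa using hA
  · simp

theorem markedType_union {D E X A : Set C} (h : ∀ x ∈ D, ∀ y ∈ E, x < y) :
    markedType n P (D ∪ E) X A = markedType n P D X A * markedType n P E X A :=
  chainType_union n h _

/-- Infinitely many tails of the sum share one type. Start at such a tail: any marked point lies
before a later tail of the same type, so the mark affects only a left factor. -/
theorem exists_endsInOwnType_of_increasing {H A : ℕ → Set C} (hH : ∀ i, (H i).OrdConnected)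
    (hlt : ∀ i j, i < j → ∀ x ∈ H i, ∀ y ∈ H j, x < y) (hAH : ∀ i, A i ⊆ H i)
    (hA : ∀ i, (A i).Nonempty) :
    ∃ U B : Set C, U.OrdConnected ∧ B ⊆ U ∧ B.Nonempty ∧
      (∀ x ∈ U, (∃ i, ∃ h ∈ H i, h ≤ x) ∧ ∃ i, ∃ h ∈ H i, x ≤ h) ∧ EndsInOwnType n P U B ∧
      ∃ i, markedType n P U ∅ B ∈ principalIdeal (markedType n P (H i) ∅ (A i)) := by
  set B₀ : Set C := ⋃ i, A i with hB₀
  set U : ℕ → Set C := fun i => {x | (∃ h ∈ H i, h ≤ x) ∧ ∃ j, ∃ h ∈ H j, x ≤ h} with hU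
  have hsplit : ∀ i j, ∀ x ∈ U i \ U j, ∀ y ∈ U j, x < y := by
    rintro i j x ⟨hx, hxj⟩ y ⟨⟨h, hh, hhy⟩, -⟩
    exact (lt_of_not_ge fun hhx => hxj ⟨⟨h, hh, hhx⟩, hx.2⟩).trans_le hhy
  have hanti : ∀ i j, i ≤ j → U j ⊆ U i := by
    rintro i j hij x ⟨⟨h, hh, hhx⟩, hx⟩
    rcases hij.eq_or_lt with rfl | hij
    · exact ⟨⟨h, hh, hhx⟩, hx⟩
    · obtain ⟨b, hb⟩ := hA i
      exact ⟨⟨b, hAH i hb, (hlt i j hij b (hAH i hb) h hh).le.trans hhx⟩, hx⟩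
  have hAU : ∀ i, A i ⊆ U i := fun i a ha => ⟨⟨a, hAH i ha, le_rfl⟩, i, a, hAH i ha, le_rfl⟩
  have hHU : ∀ i, H i ⊆ U i := fun i a ha => ⟨⟨a, ha, le_rfl⟩, i, a, ha, le_rfl⟩
  have hAnot : ∀ i j, i < j → ∀ a ∈ H i, a ∉ U j := by
    rintro i j hij a ha ⟨⟨h, hh, hha⟩, -⟩
    exact (hlt i j hij a ha h hh).not_ge hha
  obtain ⟨y, hy⟩ := Finite.exists_infinite_fiber fun i => markedType n P (U i) ∅ B₀
  have hinf := Set.infinite_coe_iff.1 hy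
  obtain ⟨i₀, hi₀⟩ := hinf.nonempty
  have hi₀' : markedType n P (U i₀) ∅ B₀ = y := hi₀
  have hB : ∀ X, markedType n P (U i₀) X (B₀ ∩ U i₀) = markedType n P (U i₀) X B₀ := fun X =>
    markedType_congr (fun _ _ => Iff.rfl) fun x hx => and_iff_left hx
  refine ⟨U i₀, B₀ ∩ U i₀, ⟨?_⟩, Set.inter_subset_right, ?_, ?_, ?_, i₀, ?_⟩
  · rintro x ⟨⟨h, hh, hhx⟩, -⟩ z ⟨-, j, h', hh', hzh'⟩ t ht
    exact ⟨⟨h, hh, hhx.trans ht.1⟩, j, h', hh', ht.2.trans hzh'⟩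
  · obtain ⟨a, ha⟩ := hA i₀
    exact ⟨a, Set.mem_iUnion.2 ⟨i₀, ha⟩, hAU i₀ ha⟩
  · exact fun x hx => ⟨⟨i₀, hx.1⟩, hx.2⟩
  · rintro a ⟨ha, -⟩
    obtain ⟨i, hi⟩ := Set.mem_iUnion.1 ha
    obtain ⟨j, hj, hij⟩ := hinf.exists_gt (max i i₀)
    have hj' : markedType n P (U j) ∅ B₀ = y := hj
    refine ⟨markedType n P (U i₀ \ U j) {a} B₀, ?_⟩
    have haj : a ∉ U j := hAnot i j ((le_max_left _ _).trans_lt hij) a (hAH i hi)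
    have hunion : U i₀ = (U i₀ \ U j) ∪ U j :=
      (Set.sdiff_union_of_subset (hanti _ _ ((le_max_right _ _).trans hij.le))).symm
    rw [hB, hB, hi₀', ← hj']
    conv_lhs => rw [hunion, markedType_union (hsplit i₀ j)]
    refine congrArg _ (markedType_congr (fun x hx => ?_) fun _ _ => Iff.rfl)
    simp only [Set.mem_singleton_iff, Set.mem_empty_iff_false, iff_false]
    rintro rfl
    exact haj hx
  -- `H i₀` is an initial segment of `U i₀`, so its type is a left factor of the whole.
  · have hunion : U i₀ = H i₀ ∪ (U i₀ \ H i₀) := (Set.union_sdiff_cancel (hHU i₀)).symm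
    have hlt' : ∀ x ∈ H i₀, ∀ z ∈ U i₀ \ H i₀, x < z := by
      rintro x hx z ⟨⟨⟨h, hh, hhz⟩, -⟩, hz⟩
      exact lt_of_not_ge fun hzx => hz ((hH i₀).out hh hx ⟨hhz, hzx⟩)
    refine ⟨1, markedType n P (U i₀ \ H i₀) ∅ B₀, ?_⟩
    rw [hB, one_mul]
    conv_lhs => rw [hunion, markedType_union hlt']
    refine congrArg (· * _) (markedType_congr (fun _ _ => Iff.rfl) fun x hx => ?_)
    refine ⟨fun hxB => ?_, fun hxA => Set.mem_iUnion.2 ⟨i₀, hxA⟩⟩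
    obtain ⟨i, hi⟩ := Set.mem_iUnion.1 hxB
    rcases lt_trichotomy i i₀ with h | rfl | h
    · exact absurd (hlt i i₀ h x (hAH i hi) x hx) (lt_irrefl x)
    · exact hi
    · exact absurd (hlt i₀ i h x hx x (hAH i hi)) (lt_irrefl x)

/-- The points strictly between two subsets of a chain. -/
def gap (D E : Set C) : Set C := {x | (∀ d ∈ D, d < x) ∧ ∀ e ∈ E, x < e}

/-- If `y` lay in the ideal of the type of the whole sum, then `y` would absorb an idempotent power
`w ^ p` of the type `w` of a gap followed by a segment. A marked point could then be moved `p`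
segments down without changing the type, making the sum ambiguous. -/
theorem exists_type_of_homogeneous_decreasing {H A : ℕ → Set C} (hH : ∀ i, (H i).OrdConnected)
    (hlt : ∀ i j, i < j → ∀ x ∈ H i, ∀ y ∈ H j, y < x) (hAH : ∀ i, A i ⊆ H i)
    (hA : ∀ i, (A i).Nonempty) (hends : ∀ i, EndsInOwnType n P (H i) (A i))
    (hamb : ∀ U B, ¬ Ambiguous n P U B) {y g : ChainType n (l + 2)}
    {S : Set (ChainType n (l + 2))} (hy : ∀ i, markedType n P (H i) ∅ (A i) = y)
    (hS : ∀ i, {t | ∃ a ∈ A i, markedType n P (H i) {a} (A i) = t} = S)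
    (hg : ∀ i, markedType n P (gap (H (i + 1)) (H i)) ∅ ∅ = g) :
    ∃ V B : Set C, V.OrdConnected ∧ B ⊆ V ∧ B.Nonempty ∧
      (∀ x ∈ V, (∃ i, ∃ h ∈ H i, h ≤ x) ∧ ∃ i, ∃ h ∈ H i, x ≤ h) ∧
      markedType n P V ∅ B ∈ principalIdeal y ∧ y ∉ principalIdeal (markedType n P V ∅ B) := by
  have hHne : ∀ i, (H i).Nonempty := fun i => (hA i).mono (hAH i)
  set B : Set C := ⋃ i, A i with hB
  set V : ℕ → Set C := fun m => {x | (∃ h ∈ H m, x ≤ h) ∧ ∃ j, ∃ h ∈ H j, h ≤ x} with hV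
  set G : ℕ → Set C := fun m => gap (H (m + 1)) (H m) with hG
  have hHV : ∀ i, H i ⊆ V i := fun i a ha => ⟨⟨a, ha, le_rfl⟩, i, a, ha, le_rfl⟩
  have hVG : ∀ m, ∀ x ∈ V (m + 1), ∀ z ∈ G m ∪ H m, x < z := by
    rintro m x ⟨⟨h, hh, hxh⟩, -⟩ z (hz | hz)
    · exact hxh.trans_lt (hz.1 h hh)
    · exact hxh.trans_lt (hlt m (m + 1) m.lt_succ_self z hz h hh)
  have hGH : ∀ m, ∀ x ∈ G m, ∀ z ∈ H m, x < z := fun m x hx z hz => hx.2 z hz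
  have hVdec : ∀ m, V m = V (m + 1) ∪ (G m ∪ H m) := by
    intro m
    refine Set.Subset.antisymm (fun x hx => ?_) ?_
    · obtain ⟨⟨h, hh, hxh⟩, hx'⟩ := hx
      by_cases h1 : ∃ h' ∈ H m, h' ≤ x
      · obtain ⟨h', hh', hhx⟩ := h1
        exact Or.inr (Or.inr ((hH m).out hh' hh ⟨hhx, hxh⟩))
      by_cases h2 : ∃ h' ∈ H (m + 1), x ≤ h'
      · exact Or.inl ⟨h2, hx'⟩
      push Not at h1 h2
      exact Or.inr (Or.inl ⟨h2, h1⟩)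
    · obtain ⟨b, hb⟩ := hHne m
      obtain ⟨c, hc⟩ := hHne (m + 1)
      rintro x (⟨⟨h, hh, hxh⟩, hx⟩ | hx | hx)
      · exact ⟨⟨b, hb, hxh.trans (hlt m (m + 1) m.lt_succ_self b hb h hh).le⟩, hx⟩
      · exact ⟨⟨b, hb, (hx.2 b hb).le⟩, m + 1, c, hc, (hx.1 c hc).le⟩
      · exact hHV m hx
  have hHB : ∀ i, ∀ x ∈ H i, x ∈ B ↔ x ∈ A i := by
    refine fun i x hx => ⟨fun hxB => ?_, fun hxA => Set.mem_iUnion.2 ⟨i, hxA⟩⟩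
    obtain ⟨j, hj⟩ := Set.mem_iUnion.1 hxB
    rcases lt_trichotomy i j with h | rfl | h
    · exact absurd (hlt i j h x hx x (hAH j hj)) (lt_irrefl x)
    · exact hj
    · exact absurd (hlt j i h x (hAH j hj) x hx) (lt_irrefl x)
  have hGB : ∀ i, ∀ x ∈ G i, x ∈ B ↔ x ∈ (∅ : Set C) := by
    refine fun i x hx => ⟨fun hxB => ?_, fun h => absurd h (Set.notMem_empty x)⟩
    obtain ⟨j, hj⟩ := Set.mem_iUnion.1 hxB
    obtain ⟨b, hb⟩ := hHne i
    obtain ⟨c, hc⟩ := hHne (i + 1)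
    rcases lt_trichotomy i j with h | rfl | h
    · rcases (Nat.succ_le_of_lt h).eq_or_lt with rfl | h
      · exact absurd (hx.1 x (hAH _ hj)) (lt_irrefl x)
      · exact absurd ((hlt _ j h c hc x (hAH _ hj)).trans (hx.1 c hc)) (lt_irrefl x)
    · exact absurd (hx.2 x (hAH _ hj)) (lt_irrefl x)
    · exact absurd ((hx.2 b hb).trans (hlt j i h x (hAH _ hj) b hb)) (lt_irrefl x)
  set τ : Set C → Set C → ChainType n (l + 2) := fun D X => markedType n P D X B with hτ
  have hτdec : ∀ m X, τ (V m) X = τ (V (m + 1)) X * (τ (G m) X * τ (H m) X) := by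
    intro m X
    conv_lhs => rw [hVdec m]
    rw [hτ]
    simp only
    rw [markedType_union (hVG m), markedType_union (hGH m)]
  have hτG : ∀ m X, (∀ x ∈ G m, x ∉ X) → τ (G m) X = g := fun m X hX =>
    (markedType_congr (fun x hx => iff_of_false (hX x hx) (Set.notMem_empty x)) (hGB m)).trans (hg m)
  have hτH : ∀ m X, τ (H m) X = markedType n P (H m) X (A m) := fun m X =>
    markedType_congr (fun _ _ => Iff.rfl) (hHB m)
  have hτH' : ∀ m X, (∀ x ∈ H m, x ∉ X) → τ (H m) X = y := fun m X hX =>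
    (markedType_congr (fun x hx => iff_of_false (hX x hx) (Set.notMem_empty x)) (hHB m)).trans (hy m)
  set w := g * y with hw
  have hstep : ∀ m X, X ⊆ V (m + 1) → τ (V m) X = τ (V (m + 1)) X * w := by
    intro m X hX
    rw [hτdec, hτG m X fun x hx hxX => lt_irrefl x (hVG m x (hX hxX) x (Or.inl hx)),
      hτH' m X fun x hx hxX => lt_irrefl x (hVG m x (hX hxX) x (Or.inr hx))]
  have hanti : ∀ m, V (m + 1) ⊆ V m := fun m x hx => by
    rw [hVdec m]
    exact Or.inl hx
  have hpow : ∀ k m X, X ⊆ V (m + k) → τ (V m) X = τ (V (m + k)) X * w ^ k := by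
    intro k
    induction k with
    | zero => simp
    | succ k ih =>
      intro m X hX
      rw [ih m X (hX.trans (hanti _)), hstep (m + k) X hX, pow_succ', mul_assoc]
      rfl
  -- Each remainder type `τ (V m) ∅` ends in the factor `w ^ p`, so it is fixed by it and is
  -- periodic in `m` with period `p`.
  obtain ⟨p, hp, he⟩ := exists_pow_mul_pow_eq_pow w
  have hzw : ∀ m, τ (V m) ∅ * w ^ p = τ (V m) ∅ := fun m => by
    rw [hpow p m ∅ (Set.empty_subset _), mul_assoc, he]
  have hz : ∀ m, τ (V m) ∅ = τ (V (m + p)) ∅ := fun m => by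
    rw [hpow p m ∅ (Set.empty_subset _), hzw]
  have hz0 : τ (V 0) ∅ = (τ (V 1) ∅ * g) * y := by
    rw [hstep 0 ∅ (Set.empty_subset _), hw, mul_assoc]
  have hconv : (V 0).OrdConnected := ⟨by
    rintro x ⟨-, j, h', hh', hzh'⟩ z ⟨⟨h, hh, hhx⟩, -⟩ t ht
    exact ⟨⟨h, hh, ht.2.trans hhx⟩, j, h', hh', hzh'.trans ht.1⟩⟩
  have hV0 : ∀ m, V m ⊆ V 0 := fun m => by
    induction m with
    | zero => exact subset_rfl
    | succ m ih => exact (hanti m).trans ih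
  have hBV : B ⊆ V 0 := Set.iUnion_subset fun i => (hAH i).trans ((hHV i).trans (hV0 i))
  have hBne : B.Nonempty := (hA 0).mono (Set.subset_iUnion A 0)
  refine ⟨V 0, B, hconv, hBV, hBne, fun x hx => ⟨hx.2, 0, hx.1⟩,
    ⟨τ (V 1) ∅ * g, 1, by rw [mul_one]; exact hz0⟩, ?_⟩
  rintro ⟨u, v, huv⟩
  -- Here `y` becomes a left multiple of `τ (V 0) ∅`, which absorbs `w ^ p` on the right.
  have hyw : y * w ^ p = y := by
    obtain ⟨v', hv'⟩ := exists_eq_mul_of_eq_mul_mul (a := u) (b := v)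
      (u := τ (V 1) ∅ * g) (y := y) (by rw [← hz0]; exact huv)
    rw [← hz0] at hv'
    conv_lhs => rw [hv', mul_assoc, hzw 0, ← hv']
  have hval : ∀ i, ∀ a ∈ A i,
      τ (V 0) {a} = τ (V (i + 1)) ∅ * (g * markedType n P (H i) {a} (A i)) * w ^ i := by
    intro i a ha
    have haH := hAH i ha
    have h1 := hpow i 0 {a} (by
      rw [zero_add]
      exact Set.singleton_subset_iff.2 (hHV i haH))
    rw [zero_add] at h1
    rw [h1, hτdec, hτH, hτG i {a} fun x hx hxa => ?_]
    · refine congrArg (fun t => t * _ * _) (markedType_congr (fun x hx => ?_) fun _ _ => Iff.rfl)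
      refine iff_of_false (fun hxa => ?_) (Set.notMem_empty x)
      exact lt_irrefl x (hVG i x hx x (Or.inr (by rwa [Set.mem_singleton_iff.1 hxa])))
    · exact lt_irrefl x (hGH i x hx x (by rwa [Set.mem_singleton_iff.1 hxa]))
  refine hamb (V 0) B ⟨hconv, hBV, hBne, fun a ha => ?_⟩
  obtain ⟨i, hi⟩ := Set.mem_iUnion.1 ha
  -- The constant `S` supplies a point with the same local marked type. That type is a left multiple
  -- of `y`, so the `p` additional factors `w` to its right are absorbed.
  obtain ⟨b, hb, hbt⟩ : ∃ b ∈ A (i + p),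
      markedType n P (H (i + p)) {b} (A (i + p)) = markedType n P (H i) {a} (A i) := by
    have : markedType n P (H i) {a} (A i) ∈ S := hS i ▸ ⟨a, hi, rfl⟩
    rw [← hS (i + p)] at this
    exact this
  refine ⟨b, Set.mem_iUnion.2 ⟨i + p, hb⟩,
    (hlt i (i + p) (by omega) a (hAH i hi) b (hAH _ hb)).ne, ?_⟩
  obtain ⟨r, hr⟩ := hends i a hi
  rw [hy] at hr
  change τ (V 0) {a} = τ (V 0) {b}
  rw [hval i a hi, hval (i + p) b hb, hbt, hr, hz (i + 1), show i + 1 + p = i + p + 1 by omega,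
    add_comm i p, pow_add w p i]
  simp only [mul_assoc]
  rw [← mul_assoc y (w ^ p), hyw]

/-- The Ramsey argument makes segment types, sets of marked types and types of consecutive gaps
constant on a subsequence. -/
theorem exists_type_of_decreasing {H A : ℕ → Set C} (hH : ∀ i, (H i).OrdConnected)
    (hlt : ∀ i j, i < j → ∀ x ∈ H i, ∀ y ∈ H j, y < x) (hAH : ∀ i, A i ⊆ H i)
    (hA : ∀ i, (A i).Nonempty) (hends : ∀ i, EndsInOwnType n P (H i) (A i))
    (hamb : ∀ U B, ¬ Ambiguous n P U B) :
    ∃ V B : Set C, V.OrdConnected ∧ B ⊆ V ∧ B.Nonempty ∧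
      (∀ x ∈ V, (∃ i, ∃ h ∈ H i, h ≤ x) ∧ ∃ i, ∃ h ∈ H i, x ≤ h) ∧
      ∃ i, markedType n P V ∅ B ∈ principalIdeal (markedType n P (H i) ∅ (A i)) ∧
        markedType n P (H i) ∅ (A i) ∉ principalIdeal (markedType n P V ∅ B) := by
  obtain ⟨f, hf, ⟨y, S, g⟩, hc⟩ := exists_strictMono_forall_consecutive_eq fun i j =>
    (markedType n P (H i) ∅ (A i), {t | ∃ a ∈ A i, markedType n P (H i) {a} (A i) = t},
      markedType n P (gap (H j) (H i)) ∅ ∅)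
  simp only [Prod.mk.injEq] at hc
  obtain ⟨V, B, hV, hBV, hB, hhull, h1, h2⟩ := exists_type_of_homogeneous_decreasing
    (H := fun i => H (f i)) (A := fun i => A (f i)) (fun i => hH _)
    (fun i j hij => hlt _ _ (hf hij)) (fun i => hAH _) (fun i => hA _) (fun i => hends _) hamb
    (fun i => (hc i).1) (fun i => (hc i).2.1) (fun i => (hc i).2.2)
  refine ⟨V, B, hV, hBV, hB, fun x hx => ?_, f 0, ?_⟩
  · obtain ⟨⟨i, hi⟩, j, hj⟩ := hhull x hx
    exact ⟨⟨f i, hi⟩, f j, hj⟩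
  · rw [(hc 0).1]
    exact ⟨h1, h2⟩

/-- Two levels of the tree pay for one strict descent: the decreasing level shrinks the ideal, and
the increasing level above it restores `EndsInOwnType` without enlarging the ideal. -/
theorem exists_endsInOwnType_of_alternatingTree (hamb : ∀ U B, ¬ Ambiguous n P U B) {k : ℕ}
    {D : Set C} (h : AlternatingTree (fun x y : C => x < y) (2 * k + 1) D) :
    ∃ U B : Set C, U.OrdConnected ∧ B ⊆ U ∧ B.Nonempty ∧
      (∀ x ∈ U, (∃ d ∈ D, d ≤ x) ∧ ∃ d ∈ D, x ≤ d) ∧ EndsInOwnType n P U B ∧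
      (principalIdeal (markedType n P U ∅ B)).ncard + k ≤ Nat.card (ChainType n (l + 2)) := by
  induction k generalizing D with
  | zero =>
    obtain ⟨E, hED, hE, hne⟩ := h
    choose e he using hne
    obtain ⟨U, B, hU, hBU, hB, hhull, hends, -⟩ := exists_endsInOwnType_of_increasing (n := n)
      (P := P) (H := fun i => {e i}) (A := fun i => {e i}) (fun i => Set.ordConnected_singleton)
      (fun i j hij x hx y hy => by
        rw [Set.mem_singleton_iff.1 hx, Set.mem_singleton_iff.1 hy]
        exact hE i j hij _ (he i) _ (he j))
      (fun i => subset_rfl) (fun i => Set.singleton_nonempty _)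
    refine ⟨U, B, hU, hBU, hB, fun x hx => ?_, hends, Set.ncard_le_card _⟩
    obtain ⟨⟨i, _, rfl, hi⟩, j, _, rfl, hj⟩ := hhull x hx
    exact ⟨⟨e i, hED i (he i), hi⟩, e j, hED j (he j), hj⟩
  | succ k ih =>
    obtain ⟨E, hED, hE, hne⟩ := h
    have hnode : ∀ i, ∃ V B : Set C, V.OrdConnected ∧ B ⊆ V ∧ B.Nonempty ∧
        (∀ x ∈ V, (∃ d ∈ E i, d ≤ x) ∧ ∃ d ∈ E i, x ≤ d) ∧
        (principalIdeal (markedType n P V ∅ B)).ncard + (k + 1) ≤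
          Nat.card (ChainType n (l + 2)) := by
      intro i
      obtain ⟨F, hFE, hF, hFt⟩ := hne i
      choose H A hH hAH hA hhull hends hcard using fun j => ih (hFt j)
      obtain ⟨V, B, hV, hBV, hB, hVhull, j, h1, h2⟩ := exists_type_of_decreasing hH
        (fun a b hab x hx z hz => by
          obtain ⟨d, hd, hdx⟩ := (hhull a x hx).1
          obtain ⟨d', hd', hzd'⟩ := (hhull b z hz).2
          exact hzd'.trans_lt ((hF a b hab d hd d' hd').trans_le hdx)) hAH hA hends hamb
      refine ⟨V, B, hV, hBV, hB, fun x hx => ?_, ?_⟩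
      · obtain ⟨⟨a, t, ht, htx⟩, b, t', ht', hxt'⟩ := hVhull x hx
        obtain ⟨d, hd, hdt⟩ := (hhull a t ht).1
        obtain ⟨d', hd', htd'⟩ := (hhull b t' ht').2
        exact ⟨⟨d, hFE a hd, hdt.trans htx⟩, d', hFE b hd', hxt'.trans htd'⟩
      · have := Set.ncard_lt_ncard ((principalIdeal_subset h1).ssubset_of_mem_notMem
          (mem_principalIdeal_self _) h2) (Set.toFinite _)
        have := hcard j
        omega
    choose H A hH hAH hA hhull hcard using hnode
    obtain ⟨U, B, hU, hBU, hB, hUhull, hends, i, hi⟩ := exists_endsInOwnType_of_increasing (n := n)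
      (P := P) hH (fun a b hab x hx z hz => by
          obtain ⟨d, hd, hxd⟩ := (hhull a x hx).2
          obtain ⟨d', hd', hdz⟩ := (hhull b z hz).1
          exact hxd.trans_lt ((hE a b hab d hd d' hd').trans_le hdz)) hAH hA
    refine ⟨U, B, hU, hBU, hB, fun x hx => ?_, hends, ?_⟩
    · obtain ⟨⟨a, t, ht, htx⟩, b, t', ht', hxt'⟩ := hUhull x hx
      obtain ⟨d, hd, hdt⟩ := (hhull a t ht).1
      obtain ⟨d', hd', htd'⟩ := (hhull b t' ht').2
      exact ⟨⟨d, hED a hd, hdt.trans htx⟩, d', hED b hd', hxt'.trans htd'⟩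
    · have := Set.ncard_le_ncard (principalIdeal_subset hi) (Set.toFinite _)
      have := hcard i
      omega

theorem exists_ambiguous
    (h : ∀ k, AlternatingTree (fun x y : C => x < y) (k + 1) (Set.univ : Set C)) :
    ∃ U B, Ambiguous n P U B := by
  by_contra! hamb
  obtain ⟨U, B, -, -, -, -, -, hcard⟩ := exists_endsInOwnType_of_alternatingTree hamb
    (h (2 * Nat.card (ChainType n (l + 2))))
  have : 0 < (principalIdeal (markedType n P U ∅ B)).ncard :=
    (Set.ncard_pos (Set.toFinite _)).2 ⟨_, mem_principalIdeal_self _⟩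
  omega

/-- The parts of the chain below and above `U` contain no mark, so they contribute the same outer
factors for `a` and `b`. -/
theorem markedType_univ_eq {U A : Set C} (hU : U.OrdConnected) (hAU : A ⊆ U) {a b : C}
    (ha : a ∈ A) (hb : b ∈ A) (h : markedType n P U {a} A = markedType n P U {b} A) :
    markedType n P Set.univ {a} A = markedType n P Set.univ {b} A := by
  set L : Set C := {x | ∀ y ∈ U, x < y} with hL
  set R : Set C := {x | ∀ y ∈ U, y < x} with hR
  have huniv : (Set.univ : Set C) = L ∪ (U ∪ R) := by
    refine (Set.eq_univ_of_forall fun x => ?_).symm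
    by_cases hx : x ∈ U
    · exact Or.inr (Or.inl hx)
    by_cases hxL : ∃ y ∈ U, y ≤ x
    · obtain ⟨y, hy, hyx⟩ := hxL
      exact Or.inr (Or.inr fun z hz => lt_of_not_ge fun hxz => hx (hU.out hy hz ⟨hyx, hxz⟩))
    · push Not at hxL
      exact Or.inl hxL
  have h1 : ∀ x ∈ U, ∀ y ∈ R, x < y := fun x hx y hy => hy x hx
  have h2 : ∀ x ∈ L, ∀ y ∈ U ∪ R, x < y := by
    rintro x hx y (hy | hy)
    · exact hx y hy
    · exact (hx a (hAU ha)).trans (hy a (hAU ha))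
  have hmark : ∀ D : Set C, (∀ c ∈ A, c ∉ D) → markedType n P D {a} A = markedType n P D {b} A :=
    fun D hD => markedType_congr (fun x hx => iff_of_false
      (fun hxa => hD a ha (Set.mem_singleton_iff.1 hxa ▸ hx))
      (fun hxb => hD b hb (Set.mem_singleton_iff.1 hxb ▸ hx))) fun _ _ => Iff.rfl
  rw [huniv, markedType_union h2, markedType_union h1, markedType_union h2, markedType_union h1, h,
    hmark L fun c hc hcL => lt_irrefl c (hcL c (hAU hc)),
    hmark R fun c hc hcR => lt_irrefl c (hcR c (hAU hc))]

end Marked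

/-! ### Failure of definable choice. -/

theorem satisfiesAt_iff_of_markedType_eq {C : Type u} [LinearOrder C] {l : ℕ}
    {φ : MonadicFormula 1 (l + 1)} {P : Fin l → Set C} {a b : C} {A : Set C}
    (h : markedType φ.rank P Set.univ {a} A = markedType φ.rank P Set.univ {b} A) :
    SatisfiesAt φ a A P ↔ SatisfiesAt φ b A P :=
  φ.realize_iff_of_chainType_eq le_rfl (fun _ => 0) Fin.succ h (fun _ => rfl) (fun _ => rfl)

theorem lemma3p9 {C : Type u} [LinearOrder C] (hC : IsScatteredChain C)
    (hdeg : HdegGE Ordinal.omega0 C) (l : ℕ) (φ : MonadicFormula 1 (l + 1))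
    (P : Fin l → Set C) : ¬ DefinesChoiceFunction φ P := by
  rintro ⟨hmem, hex, huniq⟩
  obtain ⟨U, A, hU, hAU, hA, hamb⟩ := exists_ambiguous (n := φ.rank) (P := P) hdeg.alternatingTree
  obtain ⟨a, ha⟩ := hex A hA
  have haA := (hmem a A ha).2
  obtain ⟨b, hbA, hba, hab⟩ := hamb a haA
  exact hba (huniq a b A ha ((satisfiesAt_iff_of_markedType_eq
    (markedType_univ_eq hU hAU haA hbA hab)).1 ha)).symm
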